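/- **Theorem 2.2.** For complex numbers $a,q$ with $|q|<1$ write $(a;q)_\infty=\prod_{n\ge 0}(1-aq^{n})$, and let $$x(q)=\frac{(q;q^2)_\infty}{(q^3;q^6)_\infty^3}$$ (the product form of Ramanujan's cubic continued fraction, normalized by removing the factor $q^{1/3}$). Then, for every complex $q$ with $|q|<1$, $$\frac{1}{x(q)^2}-2q\,x(q)=3q^2\,\frac{(q^2;q^2)_\infty^2\,(q^{12};q^{12})_\infty^6}{(q^4;q^4)_\infty^2\,(q^6;q^6)_\infty^6}+\frac{(q^4;q^4)_\infty^6}{(q^2;q^2)_\infty^2\,(q^6;q^6)_\infty^2\,(q^{12};q^{12})_\infty^2}.$$ -/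

import Mathlib

/-- The `q`-shifted factorial `(a; q)_∞ = ∏_{n ≥ 0} (1 - a q ^ n)`, for complex `a` and `q`
(it is used for `‖q‖ < 1`, where the product converges absolutely; see `qShifted_multipliable`). -/
noncomputable def qShifted (a q : ℂ) : ℂ := ∏' n : ℕ, (1 - a * q ^ n)

/-- The normalized cubic continued fraction in product form,
`x(q) = (q; q ^ 2)_∞ / (q ^ 3; q ^ 6)_∞ ^ 3`. -/
noncomputable def cubicX (q : ℂ) : ℂ := qShifted q (q ^ 2) / qShifted (q ^ 3) (q ^ 6) ^ 3

/-- The infinite product that defines `(a; q)_∞` converges for `‖q‖ < 1`. -/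
theorem qShifted_multipliable (a : ℂ) {q : ℂ} (hq : ‖q‖ < 1) :
    Multipliable (fun n : ℕ => 1 - a * q ^ n) := by
  have h : Summable (fun n : ℕ => ‖-(a * q ^ n)‖) := by
    simpa [norm_mul, norm_pow] using
      (summable_geometric_of_lt_one (norm_nonneg q) hq).mul_left ‖a‖
  simpa [sub_eq_add_neg] using multipliable_one_add_of_summable h

/-- No division by zero: `(a; q)_∞ ≠ 0` for `‖a‖ < 1` and `‖q‖ < 1`. -/
theorem qShifted_ne_zero {a q : ℂ} (ha : ‖a‖ < 1) (hq : ‖q‖ < 1) : qShifted a q ≠ 0 := by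
  have h : Summable (fun n : ℕ => ‖-(a * q ^ n)‖) := by
    simpa [norm_mul, norm_pow] using
      (summable_geometric_of_lt_one (norm_nonneg q) hq).mul_left ‖a‖
  have h2 : ∀ n : ℕ, 1 + -(a * q ^ n) ≠ 0 := by
    intro n h0
    have h1 : a * q ^ n = 1 := by linear_combination -h0
    have h3 : ‖a * q ^ n‖ < 1 := by
      rw [norm_mul, norm_pow]
      exact (mul_le_of_le_one_right (norm_nonneg a)
        (pow_le_one₀ (norm_nonneg q) hq.le)).trans_lt ha
    rw [h1, norm_one] at h3
    exact lt_irrefl _ h3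
  simpa [qShifted, sub_eq_add_neg] using tprod_one_add_ne_zero_of_summable h2 h

open Filter Topology

/-! Write E_k = (q^k; q^k)_∞, so that x = E_1 E_6³ / (E_2 E_3³). The key is the 2-dissection
E_3³/E_1 = A + qB, where A = E_4³E_6²/(E_2²E_12) and B = E_12³/E_4 are even in q. Replacing q by -q
turns it into a formula for E_1/E_3³, namely a multiple of A - qB. With c = E_2²/E_6⁶ this gives
1/x² = c(A + qB)² and x = cB(A - qB), so the terms in AB cancel and 1/x² - 2qx = c(A² + 3q²B²),
which is the claim. The dissection (`qShifted_cube_div_dissection`) is a case of Weierstrass's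
relation `qTheta_three_term` with nome q^12. That relation is the Plücker identity for 2×2
determinants of theta series, obtained from the Jacobi triple product `thetaSeries_eq_qShifted` and
a parity splitting of double series. -/

/-! ### Dissection of infinite products -/

/-- Dissection of `(a; q)_∞` into the residue classes modulo `m` of the index. -/
theorem qShifted_dissect (a : ℂ) {q : ℂ} (hq : ‖q‖ < 1) (m : ℕ) [NeZero m] :
    qShifted a q = ∏ i ∈ Finset.range m, qShifted (a * q ^ i) (q ^ m) := by
  have hm : ‖q ^ m‖ < 1 := by
    rw [norm_pow]
    exact pow_lt_one₀ (norm_nonneg q) hq (NeZero.ne m)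
  obtain ⟨e, he'⟩ : ∃ e : Fin m × ℕ ≃ ℕ, ∀ x, e x = x.1 + m * x.2 := by
    refine ⟨(Equiv.prodComm _ _).trans (Nat.divModEquiv m).symm, fun x => ?_⟩
    simp only [Equiv.trans_apply, Equiv.prodComm_apply, Nat.divModEquiv_symm_apply,
      Prod.fst_swap, Prod.snd_swap]
    ring
  have he : ∀ x : Fin m × ℕ,
      1 - a * q ^ e x = 1 - a * q ^ (x.1 : ℕ) * (q ^ m) ^ x.2 := fun x => by
    rw [he' x, pow_add, pow_mul, mul_assoc]
  have h1 : Multipliable fun x : Fin m × ℕ => 1 - a * q ^ (x.1 : ℕ) * (q ^ m) ^ x.2 := by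
    have h := e.multipliable_iff.2 (qShifted_multipliable a hq)
    exact h.congr he
  calc qShifted a q = ∏' x, (1 - a * q ^ e x) := (e.tprod_eq fun n => 1 - a * q ^ n).symm
    _ = ∏' x : Fin m × ℕ, (1 - a * q ^ (x.1 : ℕ) * (q ^ m) ^ x.2) := by simp only [he]
    _ = ∏' i : Fin m, qShifted (a * q ^ (i : ℕ)) (q ^ m) := by
      have h2 (i : Fin m) := (qShifted_multipliable (a * q ^ (i : ℕ)) hm).hasProd
      exact (h1.hasProd.prod_fiberwise h2).tprod_eq.symm
    _ = ∏ i ∈ Finset.range m, qShifted (a * q ^ i) (q ^ m) := by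
      rw [tprod_fintype, Finset.prod_range]

theorem qShifted_mul_qShifted_neg (a : ℂ) {q : ℂ} (hq : ‖q‖ < 1) :
    qShifted a q * qShifted (-a) q = qShifted (a ^ 2) (q ^ 2) := by
  rw [qShifted, qShifted,
    ← (qShifted_multipliable a hq).tprod_mul (qShifted_multipliable (-a) hq), qShifted]
  congr 1
  ext n
  ring

/-! ### Bilateral theta series -/

/-- The bilateral series `∑ r ^ (j ^ 2) w ^ j` over all integers `j`. -/
noncomputable def thetaSeries (r w : ℂ) : ℂ := ∑' j : ℤ, r ^ (j * j) * w ^ j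

/-- This is the Jacobi theta series with τ = log r / (πi), and Im τ = -log ‖r‖ / π is positive. -/
theorem summable_thetaSeries {r w : ℂ} (hr : r ≠ 0) (hr1 : ‖r‖ < 1) (hw : w ≠ 0) :
    Summable fun j : ℤ => r ^ (j * j) * w ^ j := by
  have hpi : (Real.pi : ℂ) ≠ 0 := by exact_mod_cast Real.pi_ne_zero
  have him : 0 < (Complex.log r / (Real.pi * Complex.I)).im := by
    have : (Complex.log r / (Real.pi * Complex.I)) =
        ((Real.pi⁻¹ : ℝ) : ℂ) * (-(Complex.I * Complex.log r)) := by
      push_cast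
      field_simp
      linear_combination Complex.log r * Complex.I_sq
    rw [this, Complex.im_ofReal_mul, Complex.neg_im, Complex.I_mul_im, Complex.log_re]
    exact mul_pos (inv_pos.2 Real.pi_pos) (neg_pos.2 (Real.log_neg (norm_pos_iff.2 hr) hr1))
  refine ((summable_jacobiTheta₂_term_iff (Complex.log w / (2 * Real.pi * Complex.I)) _).2
    him).congr fun j => ?_
  rw [jacobiTheta₂_term, Complex.exp_add]
  conv_rhs => rw [← Complex.exp_log hr, ← Complex.exp_log hw, ← Complex.exp_int_mul,
    ← Complex.exp_int_mul, mul_comm]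
  congr 2
  · field_simp
  · push_cast
    field_simp

/-- Splitting the double series by the parity of the sum of its indices. -/
theorem thetaSeries_mul_thetaSeries {r u v : ℂ} (hr : r ≠ 0) (hr1 : ‖r‖ < 1) (hu : u ≠ 0)
    (hv : v ≠ 0) :
    thetaSeries r u * thetaSeries r v =
      thetaSeries (r ^ 2) (u * v) * thetaSeries (r ^ 2) (u / v) +
        r * v * (thetaSeries (r ^ 2) (r ^ 2 * (u * v)) *
          thetaSeries (r ^ 2) (u / (v * r ^ 2))) := by
  let f : (ℤ × ℤ) ⊕ (ℤ × ℤ) → ℤ × ℤ :=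
    Sum.elim (fun s => (s.1 + s.2, s.1 - s.2)) (fun s => (s.1 + s.2, s.1 - s.2 + 1))
  have hf : Function.Bijective f := by
    constructor
    · rintro (⟨s, t⟩ | ⟨s, t⟩) (⟨s', t'⟩ | ⟨s', t'⟩) h <;>
        simp only [f, Sum.elim_inl, Sum.elim_inr, Prod.mk.injEq] at h <;>
        simp only [Sum.inl.injEq, Sum.inr.injEq, Prod.mk.injEq, reduceCtorEq] <;> omega
    · rintro ⟨m, n⟩
      rcases Int.even_or_odd' (m + n) with ⟨k, hk | hk⟩
      · exact ⟨Sum.inl (k, m - k), by simp only [f, Sum.elim_inl, Prod.mk.injEq]; omega⟩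
      · exact ⟨Sum.inr (k, m - k), by simp only [f, Sum.elim_inr, Prod.mk.injEq]; omega⟩
  have hr2 : r ^ 2 ≠ 0 := pow_ne_zero 2 hr
  have hr21 : ‖r ^ 2‖ < 1 := by
    rw [norm_pow]
    exact pow_lt_one₀ (norm_nonneg r) hr1 two_ne_zero
  have hsum : ∀ {w : ℂ}, w ≠ 0 → Summable fun j : ℤ => ‖(r ^ 2) ^ (j * j) * w ^ j‖ :=
    fun hw => (summable_thetaSeries hr2 hr21 hw).norm
  have h1 := hsum (mul_ne_zero hu hv)
  have h2 := hsum (div_ne_zero hu hv)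
  have h3 := hsum (mul_ne_zero hr2 (mul_ne_zero hu hv))
  have h4 := hsum (div_ne_zero hu (mul_ne_zero hv hr2))
  simp only [thetaSeries]
  rw [tsum_mul_tsum_of_summable_norm (summable_thetaSeries hr hr1 hu).norm
    (summable_thetaSeries hr hr1 hv).norm, ← (Equiv.ofBijective f hf).tsum_eq,
    tsum_mul_tsum_of_summable_norm h1 h2, tsum_mul_tsum_of_summable_norm h3 h4, ← tsum_mul_left]
  refine HasSum.tsum_eq (HasSum.sum ?_ ?_)
  · refine (congrArg (fun g => HasSum g _) (funext fun ⟨s, t⟩ => ?_)).mpr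
      (summable_mul_of_summable_norm h1 h2).hasSum
    simp only [f, Function.comp_apply, Equiv.ofBijective_apply, Sum.elim_inl, mul_zpow, div_zpow,
      ← zpow_natCast, ← zpow_mul, zpow_add₀ hu, zpow_sub₀ hv]
    have : ((s + t) * (s + t) : ℤ) = (2 : ℕ) * (s * s) + (2 : ℕ) * (t * t)
        - (s - t) * (s - t) := by push_cast; ring
    rw [this, zpow_sub₀ hr, zpow_add₀ hr]
    field_simp
  · refine (congrArg (fun g => HasSum g _) (funext fun ⟨s, t⟩ => ?_)).mpr
      ((summable_mul_of_summable_norm h3 h4).mul_left (r * v)).hasSum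
    simp only [f, Function.comp_apply, Equiv.ofBijective_apply, Sum.elim_inr, mul_zpow, div_zpow,
      ← zpow_natCast, ← zpow_mul, zpow_add₀ hu, zpow_sub₀ hv, zpow_add₀ hv, zpow_one]
    have : ((s + t) * (s + t) : ℤ) = (2 : ℕ) * (s * s) + (2 : ℕ) * (t * t) + 1 + (2 : ℕ) * s
        - (2 : ℕ) * t - (s - t + 1) * (s - t + 1) := by push_cast; ring
    rw [this, zpow_sub₀ hr, zpow_sub₀ hr, zpow_add₀ hr, zpow_add₀ hr, zpow_add₀ hr, zpow_one]
    field_simp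

/-! ### The Jacobi triple product -/

/-- The finite product `(p; p)_n`. -/
noncomputable def qFact (p : ℂ) (n : ℕ) : ℂ := ∏ k ∈ Finset.range n, (1 - p ^ (k + 1))

/-- The reciprocal of `(p; p)_m`, extended by zero to negative `m`. -/
noncomputable def qFactInv (p : ℂ) : ℤ → ℂ
  | .ofNat m => (qFact p m)⁻¹
  | .negSucc _ => 0

theorem one_sub_pow_succ_ne_zero {p : ℂ} (hp1 : ‖p‖ < 1) (n : ℕ) : 1 - p ^ (n + 1) ≠ 0 := by
  intro h
  have h1 : ‖p ^ (n + 1)‖ < 1 := by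
    rw [norm_pow]
    exact pow_lt_one₀ (norm_nonneg p) hp1 n.succ_ne_zero
  rw [← sub_eq_zero.1 h, norm_one] at h1
  exact lt_irrefl _ h1

/-- Extension by zero makes the recurrence hold for every integer: at m = 0 the factor 1 - p^m
vanishes. -/
theorem qFactInv_sub_one {p : ℂ} (hp1 : ‖p‖ < 1) (m : ℤ) :
    qFactInv p (m - 1) = (1 - p ^ m) * qFactInv p m := by
  rcases m with (_ | m) | m
  · change (0 : ℂ) = (1 - p ^ (0 : ℤ)) * _
    simp
  · have h : (Int.ofNat (m + 1) - 1 : ℤ) = Int.ofNat m := by simp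
    have h2 : p ^ (Int.ofNat (m + 1)) = p ^ (m + 1) := zpow_natCast p (m + 1)
    have := one_sub_pow_succ_ne_zero hp1 m
    rw [h, h2]
    simp only [qFactInv, qFact, Finset.prod_range_succ, mul_inv]
    field_simp
  · have h : (Int.negSucc m - 1 : ℤ) = Int.negSucc (m + 1) := by omega
    rw [h]
    simp [qFactInv]

/-- The coefficients of the finite form of the Jacobi triple product. -/
noncomputable def tripleCoeff (p : ℂ) (n : ℕ) (j : ℤ) : ℂ :=
  qFact p (2 * n) * qFactInv p (n + j) * qFactInv p (n - j)

theorem tripleCoeff_succ {p : ℂ} (hp : p ≠ 0) (hp1 : ‖p‖ < 1) (n : ℕ) (j : ℤ) :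
    tripleCoeff p (n + 1) j = (1 + p ^ (2 * n + 1)) * tripleCoeff p n j +
      p ^ (n + 1 - j) * tripleCoeff p n (j - 1) + p ^ (n + 1 + j) * tripleCoeff p n (j + 1) := by
  have e1 : qFactInv p (n + j) = (1 - p ^ (n + 1 + j)) * qFactInv p (n + 1 + j) := by
    rw [← qFactInv_sub_one hp1]; congr 1; ring
  have e2 : qFactInv p (n - j) = (1 - p ^ (n + 1 - j)) * qFactInv p (n + 1 - j) := by
    rw [← qFactInv_sub_one hp1]; congr 1; ring
  have e3 : qFactInv p (n + (j - 1)) = (1 - p ^ (n + j)) * qFactInv p (n + j) := by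
    rw [← qFactInv_sub_one hp1]; congr 1; ring
  have e4 : qFactInv p (n - (j + 1)) = (1 - p ^ (n - j)) * qFactInv p (n - j) := by
    rw [← qFactInv_sub_one hp1]; congr 1; ring
  have e5 : qFactInv p (n - (j - 1)) = qFactInv p (n + 1 - j) := by congr 1; ring
  have e6 : qFactInv p (n + (j + 1)) = qFactInv p (n + 1 + j) := by congr 1; ring
  have a1 : p ^ (n + 1 + j : ℤ) = p * p ^ (n + j : ℤ) := by
    rw [← zpow_one_add₀ hp]; congr 1; ring
  have b1 : p ^ (n + 1 - j : ℤ) = p * p ^ (n - j : ℤ) := by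
    rw [← zpow_one_add₀ hp]; congr 1; ring
  have ab : p ^ (2 * n) = p ^ (n + j : ℤ) * p ^ (n - j : ℤ) := by
    rw [← zpow_add₀ hp, ← zpow_natCast]; congr 1; push_cast; ring
  have hP : qFact p (2 * (n + 1)) =
      qFact p (2 * n) * (1 - p ^ (2 * n) * p) * (1 - p ^ (2 * n) * p ^ 2) := by
    rw [show 2 * (n + 1) = 2 * n + 1 + 1 by ring]
    simp only [qFact, Finset.prod_range_succ]
    ring
  simp only [tripleCoeff, Nat.cast_add, Nat.cast_one]
  rw [e5, e6, e3, e4, e1, e2, hP, a1, b1, pow_succ p (2 * n), ab]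
  ring

/-- The finite form of the Jacobi triple product. -/
theorem hasSum_tripleCoeff {r z : ℂ} (hr : r ≠ 0) (hr1 : ‖r ^ 2‖ < 1) (hz : z ≠ 0) (n : ℕ) :
    HasSum (fun j : ℤ => tripleCoeff (r ^ 2) n j * (r ^ (j * j) * (-z / r) ^ j))
      (∏ k ∈ Finset.range n, ((1 - z * (r ^ 2) ^ k) * (1 - r ^ 2 / z * (r ^ 2) ^ k))) := by
  induction n with
  | zero =>
    have h0 : ∀ j : ℤ, j ≠ 0 →
        tripleCoeff (r ^ 2) 0 j * (r ^ (j * j) * (-z / r) ^ j) = 0 := by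
      rintro ((_ | j) | j) hj
      · exact absurd rfl hj
      · have : (-Int.ofNat (j + 1) : ℤ) = Int.negSucc j := rfl
        simp only [tripleCoeff, Nat.cast_zero, zero_sub, this]
        simp only [qFactInv, mul_zero, zero_mul]
      · simp [tripleCoeff, qFactInv]
    have h1 : tripleCoeff (r ^ 2) 0 0 = 1 := by
      simp [tripleCoeff, qFact, show qFactInv (r ^ 2) 0 = 1 by
        change (qFact (r ^ 2) 0)⁻¹ = 1
        simp [qFact]]
    simpa [h1] using hasSum_single (0 : ℤ) h0
  | succ n ih =>
    have hp : r ^ 2 ≠ 0 := pow_ne_zero 2 hr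
    have hw : -z / r ≠ 0 := div_ne_zero (neg_ne_zero.2 hz) hr
    have hT : ∀ j : ℤ, r ^ ((j + 1) * (j + 1)) * (-z / r) ^ (j + 1) =
        r ^ (j * j) * (-z / r) ^ j * ((r ^ 2) ^ j * (-z)) := by
      intro j
      rw [show (j + 1) * (j + 1) = j * j + (2 : ℤ) * j + 1 by ring, zpow_add₀ hr,
        zpow_add₀ hr, zpow_one, zpow_add₀ hw, zpow_one, zpow_mul r 2, zpow_ofNat]
      field_simp
    -- With p = r², the new factor is (1 - zp^n)(1 - p^(n+1)/z) = 1 + p^(2n+1) - zp^n - p^(n+1)/z;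
    -- its last two terms shift the index j by one.
    have h1 := ((Equiv.subRight (1 : ℤ)).hasSum_iff.2 ih).mul_left (-z * (r ^ 2) ^ n)
    have h2 := ((Equiv.addRight (1 : ℤ)).hasSum_iff.2 ih).mul_left (-(r ^ 2) ^ (n + 1) / z)
    have h3 := ((ih.mul_left (1 + (r ^ 2) ^ (2 * n + 1))).add h1).add h2
    rw [Finset.prod_range_succ]
    refine (congrArg₂ (fun f a => HasSum f a) (funext fun j => ?_) ?_).mpr h3
    · simp only [Function.comp_apply, Equiv.coe_addRight, Equiv.subRight_apply]
      have hj := hT (j - 1)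
      rw [sub_add_cancel] at hj
      rw [tripleCoeff_succ hp hr1, hT j, hj,
        show (n + 1 - j : ℤ) = n - (j - 1) by ring,
        zpow_sub₀ hp, zpow_add₀ hp (n + 1), zpow_add₀ hp n, zpow_natCast, zpow_one]
      have := zpow_ne_zero (j - 1) hp
      field_simp
      ring
    · field_simp
      ring

theorem tendsto_qFact {p : ℂ} (hp1 : ‖p‖ < 1) : Tendsto (qFact p) atTop (𝓝 (qShifted p p)) := by
  refine (qShifted_multipliable p hp1).tendsto_prod_tprod_nat.congr fun n => ?_
  simp only [qFact, pow_succ']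

theorem tendsto_qFactInv {p : ℂ} (hp1 : ‖p‖ < 1) :
    Tendsto (fun n : ℕ => qFactInv p n) atTop (𝓝 (qShifted p p)⁻¹) :=
  (tendsto_qFact hp1).inv₀ (qShifted_ne_zero hp1 hp1)

theorem exists_norm_qFactInv_le {p : ℂ} (hp1 : ‖p‖ < 1) : ∃ C, ∀ m : ℤ, ‖qFactInv p m‖ ≤ C := by
  obtain ⟨C, hC⟩ := (tendsto_qFactInv hp1).norm.bddAbove_range
  have hC' : ∀ n : ℕ, ‖qFactInv p n‖ ≤ C := fun n => hC ⟨n, rfl⟩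
  refine ⟨C, ?_⟩
  rintro (m | m)
  · exact hC' m
  · simpa [qFactInv] using (norm_nonneg _).trans (hC' 0)

theorem tendsto_tripleCoeff {p : ℂ} (hp1 : ‖p‖ < 1) (j : ℤ) :
    Tendsto (fun n => tripleCoeff p n j) atTop (𝓝 (qShifted p p)⁻¹) := by
  have hE := qShifted_ne_zero hp1 hp1
  have h1 : Tendsto (qFactInv p) atTop (𝓝 (qShifted p p)⁻¹) := by
    have h : Tendsto Int.toNat atTop atTop := tendsto_atTop.2 fun b =>
      (eventually_ge_atTop (b : ℤ)).mono fun m hm => by omega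
    refine ((tendsto_qFactInv hp1).comp h).congr' ?_
    filter_upwards [eventually_ge_atTop 0] with m hm
    simp [Int.toNat_of_nonneg hm]
  have hn : Tendsto (fun n : ℕ => (n : ℤ)) atTop atTop := tendsto_natCast_atTop_atTop
  have h2 := h1.comp (tendsto_atTop_add_const_right _ j hn)
  have h3 := h1.comp (tendsto_atTop_add_const_right _ (-j) hn)
  have h4 := (tendsto_qFact hp1).comp (tendsto_id.const_mul_atTop' (r := 2) two_pos)
  have h5 := (h4.mul h2).mul h3
  rw [mul_inv_cancel₀ hE, one_mul] at h5
  exact h5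

/-- The Jacobi triple product identity. -/
theorem thetaSeries_eq_qShifted {r z : ℂ} (hr : r ≠ 0) (hr1 : ‖r‖ < 1) (hz : z ≠ 0) :
    thetaSeries r (-z / r) =
      qShifted (r ^ 2) (r ^ 2) * (qShifted z (r ^ 2) * qShifted (r ^ 2 / z) (r ^ 2)) := by
  have hp1 : ‖r ^ 2‖ < 1 := by
    rw [norm_pow]
    exact pow_lt_one₀ (norm_nonneg r) hr1 two_ne_zero
  have hE := qShifted_ne_zero hp1 hp1
  have hs := summable_thetaSeries hr hr1 (div_ne_zero (neg_ne_zero.2 hz) hr)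
  obtain ⟨C, hC⟩ := exists_norm_qFactInv_le hp1
  obtain ⟨D, hD⟩ := (tendsto_qFact hp1).norm.bddAbove_range
  have hC0 : 0 ≤ C := (norm_nonneg _).trans (hC 0)
  have hD' : ∀ n, ‖qFact (r ^ 2) n‖ ≤ D := fun n => hD ⟨n, rfl⟩
  have hD0 : 0 ≤ D := (norm_nonneg _).trans (hD' 0)
  -- The coefficients are bounded by DC² uniformly in n and j, so the theta series itself supplies
  -- the majorant.
  have h1 := tendsto_tsum_of_dominated_convergence (𝓕 := atTop) (hs.norm.mul_left (D * C * C))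
    (fun j => (tendsto_tripleCoeff hp1 j).mul_const (r ^ (j * j) * (-z / r) ^ j))
    (Eventually.of_forall fun n j => by
      rw [norm_mul]
      refine mul_le_mul_of_nonneg_right ?_ (norm_nonneg _)
      rw [tripleCoeff, norm_mul, norm_mul]
      gcongr
      exacts [hD' _, hC _, hC _])
  simp only [(hasSum_tripleCoeff hr hp1 hz _).tsum_eq, Finset.prod_mul_distrib] at h1
  have h2 := ((qShifted_multipliable z hp1).tendsto_prod_tprod_nat).mul
    ((qShifted_multipliable (r ^ 2 / z) hp1).tendsto_prod_tprod_nat)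
  have h3 := tendsto_nhds_unique h1 h2
  rw [tsum_mul_left] at h3
  change _ * thetaSeries r (-z / r) = qShifted z _ * qShifted _ _ at h3
  rw [← h3, mul_inv_cancel_left₀ hE]

/-! ### Weierstrass's three-term relation -/

/-- The theta function `θ(z; p) = (z; p)_∞ (p / z; p)_∞`. -/
noncomputable def qTheta (p z : ℂ) : ℂ := qShifted z p * qShifted (p / z) p

/-- A theta product in two variables as a determinant of theta series in one variable. -/
theorem qTheta_mul_qTheta {r x y : ℂ} (hr : r ≠ 0) (hr1 : ‖r‖ < 1) (hx : x ≠ 0) (hy : y ≠ 0) :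
    qShifted (r ^ 2) (r ^ 2) ^ 2 * (qTheta (r ^ 2) (x * y) * qTheta (r ^ 2) (x / y)) =
      thetaSeries (r ^ 2) (x ^ 2 / r ^ 2) * thetaSeries (r ^ 2) (y ^ 2) -
        x / y * (thetaSeries (r ^ 2) (x ^ 2) * thetaSeries (r ^ 2) (y ^ 2 / r ^ 2)) := by
  -- These arguments have the form -z/r of the triple product, with z = xy and z = x/y.
  have h := thetaSeries_mul_thetaSeries hr hr1
    (div_ne_zero (neg_ne_zero.2 (mul_ne_zero hx hy)) hr)
    (div_ne_zero (neg_ne_zero.2 (div_ne_zero hx hy)) hr)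
  rw [thetaSeries_eq_qShifted hr hr1 (mul_ne_zero hx hy),
    thetaSeries_eq_qShifted hr hr1 (div_ne_zero hx hy)] at h
  have e1 : -(x * y) / r * (-(x / y) / r) = x ^ 2 / r ^ 2 := by field_simp
  have e2 : -(x * y) / r / (-(x / y) / r) = y ^ 2 := by field_simp
  have e3 : r ^ 2 * (x ^ 2 / r ^ 2) = x ^ 2 := by field_simp
  have e4 : -(x * y) / r / (-(x / y) / r * r ^ 2) = y ^ 2 / r ^ 2 := by field_simp
  have e5 : r * (-(x / y) / r) = -(x / y) := by field_simp
  rw [e1, e2, e3, e4, e5] at h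
  simp only [qTheta]
  linear_combination h

/-- Weierstrass's three-term relation for theta products. -/
theorem qTheta_three_term {r x y u v : ℂ} (hr : r ≠ 0) (hr1 : ‖r‖ < 1) (hx : x ≠ 0)
    (hy : y ≠ 0) (hu : u ≠ 0) (hv : v ≠ 0) :
    qTheta (r ^ 2) (x * y) * qTheta (r ^ 2) (x / y) *
        (qTheta (r ^ 2) (u * v) * qTheta (r ^ 2) (u / v)) =
      qTheta (r ^ 2) (x * v) * qTheta (r ^ 2) (x / v) *
          (qTheta (r ^ 2) (u * y) * qTheta (r ^ 2) (u / y)) +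
        u / y * (qTheta (r ^ 2) (y * v) * qTheta (r ^ 2) (y / v) *
          (qTheta (r ^ 2) (x * u) * qTheta (r ^ 2) (x / u))) := by
  have hp1 : ‖r ^ 2‖ < 1 := by
    rw [norm_pow]
    exact pow_lt_one₀ (norm_nonneg r) hr1 two_ne_zero
  have hE := pow_ne_zero 2 (pow_ne_zero 2 (qShifted_ne_zero hp1 hp1))
  refine mul_left_cancel₀ hE ?_
  have h : ∀ E a b c d e f k : ℂ, E * a * (E * b) = E * c * (E * d) + k * (E * e * (E * f)) →
      E ^ 2 * (a * b) = E ^ 2 * (c * d + k * (e * f)) := fun E a b c d e f k h => by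
    linear_combination h
  refine h _ _ _ _ _ _ _ _ ?_
  rw [qTheta_mul_qTheta hr hr1 hx hy, qTheta_mul_qTheta hr hr1 hu hv,
    qTheta_mul_qTheta hr hr1 hx hv, qTheta_mul_qTheta hr hr1 hu hy,
    qTheta_mul_qTheta hr hr1 hy hv, qTheta_mul_qTheta hr hr1 hx hu]
  -- Each pair is now x times a 2×2 determinant in the vectors attached to x and y; what remains is
  -- the Plücker relation.
  field_simp
  ring

/-! ### Theta products with nome q^12 -/

theorem norm_pow_lt_one {q : ℂ} (hq : ‖q‖ < 1) {k : ℕ} (hk : k ≠ 0) : ‖q ^ k‖ < 1 := by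
  rw [norm_pow]
  exact pow_lt_one₀ (norm_nonneg q) hq hk

theorem qShifted_pow_ne_zero {q : ℂ} (hq : ‖q‖ < 1) {k l : ℕ} (hk : k ≠ 0) (hl : l ≠ 0) :
    qShifted (q ^ k) (q ^ l) ≠ 0 :=
  qShifted_ne_zero (norm_pow_lt_one hq hk) (norm_pow_lt_one hq hl)

theorem qTheta_pow_pow {q : ℂ} (hq0 : q ≠ 0) {k n : ℕ} (hk : k ≤ n) :
    qTheta (q ^ n) (q ^ k) = qShifted (q ^ k) (q ^ n) * qShifted (q ^ (n - k)) (q ^ n) := by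
  rw [qTheta, pow_sub₀ q hq0 hk, div_eq_mul_inv]

/-- The three-term relation at (x, y, u, v) = (q⁴, q², q³, 1), with θ(q⁷) = θ(q⁵) by the symmetry z
↦ p/z. -/
theorem qTheta_twelve_relation {q : ℂ} (hq0 : q ≠ 0) (hq : ‖q‖ < 1) :
    qTheta (q ^ 12) (q ^ 6) * qTheta (q ^ 12) (q ^ 2) * qTheta (q ^ 12) (q ^ 3) ^ 2 =
      (qTheta (q ^ 12) (q ^ 4) ^ 2 + q * qTheta (q ^ 12) (q ^ 2) ^ 2) *
        (qTheta (q ^ 12) (q ^ 5) * qTheta (q ^ 12) q) := by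
  have h := qTheta_three_term (pow_ne_zero 6 hq0) (norm_pow_lt_one hq (by norm_num))
    (pow_ne_zero 4 hq0) (pow_ne_zero 2 hq0) (pow_ne_zero 3 hq0) one_ne_zero
  have e1 : q ^ 4 / q ^ 2 = q ^ 2 := by field_simp
  have e2 : q ^ 3 / q ^ 2 = q := by field_simp
  have e3 : q ^ 4 / q ^ 3 = q := by field_simp
  have e4 : qTheta (q ^ 12) (q ^ 7) = qTheta (q ^ 12) (q ^ 5) := by
    rw [qTheta_pow_pow hq0 (by norm_num), qTheta_pow_pow hq0 (by norm_num), mul_comm]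
  simp only [mul_one, div_one, ← pow_mul, ← pow_add, e1, e2, e3, Nat.reduceMul, Nat.reduceAdd,
    e4] at h
  linear_combination h

/-- The 2-dissection of `(q³; q³)_∞³ / (q; q)_∞`. -/
theorem qShifted_cube_div_dissection {q : ℂ} (hq0 : q ≠ 0) (hq : ‖q‖ < 1) :
    qShifted (q ^ 3) (q ^ 3) ^ 3 / qShifted q q =
      qShifted (q ^ 4) (q ^ 4) ^ 3 * qShifted (q ^ 6) (q ^ 6) ^ 2 /
          (qShifted (q ^ 2) (q ^ 2) ^ 2 * qShifted (q ^ 12) (q ^ 12)) +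
        q * (qShifted (q ^ 12) (q ^ 12) ^ 3 / qShifted (q ^ 4) (q ^ 4)) := by
  have h := qTheta_twelve_relation hq0 hq
  have e := qTheta_pow_pow hq0 (k := 1) (n := 12) (by norm_num)
  rw [pow_one] at e
  rw [e] at h
  iterate 5 rw [qTheta_pow_pow hq0 (by norm_num)] at h
  simp only [Nat.reduceSub] at h
  -- Splitting modulo 12 makes every product a monomial in the (q^k; q^12)_∞.
  have d1 := qShifted_dissect q hq 12
  have d2 := qShifted_dissect (q ^ 2) (norm_pow_lt_one hq two_ne_zero) 6
  have d3 := qShifted_dissect (q ^ 3) (norm_pow_lt_one hq three_ne_zero) 4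
  have d4 := qShifted_dissect (q ^ 4) (norm_pow_lt_one hq four_ne_zero) 3
  have d6 := qShifted_dissect (q ^ 6) (norm_pow_lt_one hq (k := 6) (by norm_num)) 2
  simp only [Finset.prod_range_succ, Finset.prod_range_zero, one_mul, mul_one, pow_one,
    ← pow_succ', ← pow_mul, ← pow_add, Nat.reduceMul, Nat.reduceAdd] at d1 d2 d3 d4 d6
  have n (k : ℕ) (hk : k ≠ 0) := qShifted_pow_ne_zero hq hk (l := 12) (by norm_num)
  have n1 := n 1 (by norm_num)
  have n2 := n 2 (by norm_num)
  have n3 := n 3 (by norm_num)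
  have n4 := n 4 (by norm_num)
  have n5 := n 5 (by norm_num)
  have n6 := n 6 (by norm_num)
  have n7 := n 7 (by norm_num)
  have n8 := n 8 (by norm_num)
  have n9 := n 9 (by norm_num)
  have n10 := n 10 (by norm_num)
  have n11 := n 11 (by norm_num)
  have n12 := n 12 (by norm_num)
  rw [pow_one] at n1
  rw [d1, d2, d3, d4, d6]
  clear d1 d2 d3 d4 d6 e n
  generalize qShifted q (q ^ 12) = a1 at *
  generalize qShifted (q ^ 2) (q ^ 12) = a2 at *
  generalize qShifted (q ^ 3) (q ^ 12) = a3 at *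
  generalize qShifted (q ^ 4) (q ^ 12) = a4 at *
  generalize qShifted (q ^ 5) (q ^ 12) = a5 at *
  generalize qShifted (q ^ 6) (q ^ 12) = a6 at *
  generalize qShifted (q ^ 7) (q ^ 12) = a7 at *
  generalize qShifted (q ^ 8) (q ^ 12) = a8 at *
  generalize qShifted (q ^ 9) (q ^ 12) = a9 at *
  generalize qShifted (q ^ 10) (q ^ 12) = a10 at *
  generalize qShifted (q ^ 11) (q ^ 12) = a11 at *
  generalize qShifted (q ^ 12) (q ^ 12) = a12 at *
  field_simp
  linear_combination h

/-! ### Sign change and the final identity -/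

/-- Replacing `q` by `-q` in Euler's product. -/
theorem qShifted_neg_neg {q : ℂ} (hq : ‖q‖ < 1) :
    qShifted (-q) (-q) * (qShifted q q * qShifted (q ^ 4) (q ^ 4)) =
      qShifted (q ^ 2) (q ^ 2) ^ 3 := by
  have h1 := qShifted_dissect q hq 2
  have h2 := qShifted_dissect (-q) (q := -q) (by rwa [norm_neg]) 2
  have h3 := qShifted_dissect (q ^ 2) (norm_pow_lt_one hq two_ne_zero) 2
  have h4 := qShifted_mul_qShifted_neg q (norm_pow_lt_one hq two_ne_zero)
  simp only [Finset.prod_range_succ, Finset.prod_range_zero, one_mul, pow_zero, mul_one, pow_one,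
    neg_sq, ← sq, ← pow_mul, Nat.reduceMul] at h1 h2 h3 h4
  rw [h1, h2]
  linear_combination qShifted (q ^ 2) (q ^ 2) ^ 2 * (qShifted (q ^ 4) (q ^ 4) * h4 - h3)

theorem qShifted_zero_left (q : ℂ) : qShifted 0 q = 1 := by
  simp [qShifted]

theorem qShifted_eq_div {q : ℂ} (hq : ‖q‖ < 1) :
    qShifted q (q ^ 2) = qShifted q q / qShifted (q ^ 2) (q ^ 2) := by
  have h1 := qShifted_dissect q hq 2
  simp only [Finset.prod_range_succ, Finset.prod_range_zero, one_mul, pow_zero, mul_one, pow_one,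
    ← sq] at h1
  rw [h1, mul_div_cancel_right₀ _ (qShifted_pow_ne_zero hq two_ne_zero two_ne_zero)]

theorem theorem2p2 (q : ℂ) (hq : ‖q‖ < 1) :
    1 / cubicX q ^ 2 - 2 * q * cubicX q =
      3 * q ^ 2 *
          ((qShifted (q ^ 2) (q ^ 2) ^ 2 * qShifted (q ^ 12) (q ^ 12) ^ 6) /
            (qShifted (q ^ 4) (q ^ 4) ^ 2 * qShifted (q ^ 6) (q ^ 6) ^ 6)) +
        qShifted (q ^ 4) (q ^ 4) ^ 6 /
          (qShifted (q ^ 2) (q ^ 2) ^ 2 * qShifted (q ^ 6) (q ^ 6) ^ 2 *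
            qShifted (q ^ 12) (q ^ 12) ^ 2) := by
  rcases eq_or_ne q 0 with rfl | hq0
  · simp [cubicX, qShifted_zero_left]
  have hx : cubicX q = qShifted q q * qShifted (q ^ 6) (q ^ 6) ^ 3 /
      (qShifted (q ^ 2) (q ^ 2) * qShifted (q ^ 3) (q ^ 3) ^ 3) := by
    have h3 := qShifted_eq_div (norm_pow_lt_one hq three_ne_zero)
    rw [← pow_mul] at h3
    rw [cubicX, qShifted_eq_div hq, h3, div_pow, div_div_div_eq]
  have hdis := qShifted_cube_div_dissection hq0 hq
  have hneg := qShifted_cube_div_dissection (neg_ne_zero.2 hq0) (by rwa [norm_neg])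
  have g1 := qShifted_neg_neg hq
  have g3 := qShifted_neg_neg (norm_pow_lt_one hq three_ne_zero)
  have o3 : (-q) ^ 3 = -q ^ 3 := by ring
  have o (k : ℕ) (hk : Even k) : (-q) ^ k = q ^ k := hk.neg_pow q
  rw [o3, o 2 (by decide), o 4 (by decide), o 6 (by decide), o 12 (by decide)] at hneg
  simp only [← pow_mul, Nat.reduceMul] at g3
  have n (k : ℕ) (hk : k ≠ 0) := qShifted_pow_ne_zero hq hk hk
  have n1 := qShifted_ne_zero hq hq
  have n2 := n 2 (by norm_num)
  have n3 := n 3 (by norm_num)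
  have n4 := n 4 (by norm_num)
  have n6 := n 6 (by norm_num)
  have n12 := n 12 (by norm_num)
  rw [← eq_div_iff (mul_ne_zero n1 n4)] at g1
  rw [← eq_div_iff (mul_ne_zero n3 n12)] at g3
  rw [g1, g3] at hneg
  rw [hx]
  clear g1 g3 hx n o o3
  generalize qShifted q q = E1 at *
  generalize qShifted (q ^ 2) (q ^ 2) = E2 at *
  generalize qShifted (q ^ 3) (q ^ 3) = E3 at *
  generalize qShifted (q ^ 4) (q ^ 4) = E4 at *
  generalize qShifted (q ^ 6) (q ^ 6) = E6 at *
  generalize qShifted (q ^ 12) (q ^ 12) = E12 at *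
  -- The dissection at -q, using E_1(-q) = E_2³/(E_1E_4) and its analogue for q³.
  have hinv : E1 / E3 ^ 3 = (E4 ^ 3 * E6 ^ 2 / (E2 ^ 2 * E12) - q * (E12 ^ 3 / E4)) *
      (E12 ^ 3 * E2 ^ 3 / (E6 ^ 9 * E4)) := by
    rw [sub_eq_add_neg, ← neg_mul, ← hneg]
    field_simp
  have hL : 1 / (E1 * E6 ^ 3 / (E2 * E3 ^ 3)) ^ 2 - 2 * q * (E1 * E6 ^ 3 / (E2 * E3 ^ 3)) =
      E2 ^ 2 / E6 ^ 6 * (E3 ^ 3 / E1) ^ 2 - 2 * q * (E6 ^ 3 / E2) * (E1 / E3 ^ 3) := by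
    field_simp
  rw [hL, hdis, hinv]
  field_simp
  ring
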